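/- Let $J=\begin{pmatrix}0&0&1\\0&1&0\\1&0&0\end{pmatrix}$, let $\langle v,w\rangle=\bar v^{t}Jw$ on $\mathbb{C}^3$, and let $\mathrm{SU}(2,1)=\{g\in \mathrm{SL}_3(\mathbb{C}) : \bar g^{t}Jg=J\}$. It acts on $$\mathcal{H}=\Big\{\tau=\begin{pmatrix}\tau_1\\ \tau_2\end{pmatrix}\in\mathbb{C}^2 : \Big\langle \begin{pmatrix}\tau\\1\end{pmatrix},\begin{pmatrix}\tau\\1\end{pmatrix}\Big\rangle<0\Big\}$$ by $g*\tau=\frac{1}{C\tau+D}(A\tau+B)$ for $g=\begin{pmatrix}A&B\\C&D\end{pmatrix}$ with $A$ of size $2\times 2$; put $j(g,\tau)=C\tau+D$. If $(a,b,c)$ is the bottom row of $g$, let $X(g)=-a$ if $a\neq 0$ and $X(g)=c$ if $a=0$, and define $$\tilde j(g,\tau)=\log\Big(\frac{j(g,\tau)}{X(g)}\Big)+\log X(g),$$ where $\log$ is the principal logarithm, $-\pi<\operatorname{Im}\log z\le\pi$. For each $g\in\mathrm{SU}(2,1)$ the function $\tilde j(g,\cdot)$ is a continuous branch of $\log j(g,\cdot)$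 on $\mathcal{H}$, and for all $g,h\in \mathrm{SU}(2,1)$ the number $$\sigma(g,h)=\frac{1}{2\pi i}\Big(\tilde j(gh,\tau)-\tilde j(g,h*\tau)-\tilde j(h,\tau)\Big)$$ is an integer independent of $\tau\in\mathcal{H}$. **Proposition.** The function $\sigma:\mathrm{SU}(2,1)\times \mathrm{SU}(2,1)\to\mathbb{Z}$ is a Borel measurable inhomogeneous 2-cocycle, i.e. $\sigma(g_1,g_2)+\sigma(g_1g_2,g_3)=\sigma(g_1,g_2g_3)+\sigma(g_2,g_3)$ for all $g_1,g_2,g_3$. Its class in $H^2_{\mathrm{meas}}(\mathrm{SU}(2,1),\mathbb{Z})$ (measurable 2-cocycles modulo coboundaries of measurable functions $\mathrm{SU}(2,1)\to\mathbb{Z}$) corresponds to the universal cover of $\mathrm{SU}(2,1)$. That is, $\mathrm{SU}(2,1)$ has a universal cover (a topological group $E$ that is simply connected, with a surjective homomorphism $\pi:E\to\mathrm{SU}(2,1)$ that is a covering map), and for every universal cover $\pi:E\to \mathrm{SU}(2,1)$ there is an identification of $\ker\pi$ with $\mathbb{Z}$ making $$1\to\mathbb{Z}\xrightarrow{\ \iota\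 }E\xrightarrow{\ \pi\ }\mathrm{SU}(2,1)\to 1$$ a topological central extension whose class in $H^2_{\mathrm{meas}}(\mathrm{SU}(2,1),\mathbb{Z})$ is $[\sigma]$. Here the class of such an extension is that of the cocycle $c$ given by $s(g)s(h)=\iota(c(g,h))\,s(gh)$ for a Borel measurable section $s$ of $\pi$. -/

import Mathlib

open Complex Matrix Topology MeasureTheory

noncomputable section

namespace SU21Cover

/-! ### The group SU(2,1), its symmetric space, and the factor `j` -/

/-- The matrix of the Hermitian form: ones on the antidiagonal, zeros elsewhere. -/
def J : Matrix (Fin 3) (Fin 3) ℂ := !![0, 0, 1; 0, 1, 0; 1, 0, 0]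

/-- The Hermitian form `⟨v, w⟩ = v̄ᵗ J w` on `ℂ³`. -/
def herm (v w : Fin 3 → ℂ) : ℂ := star v ⬝ᵥ (J *ᵥ w)

/-- The underlying matrix of an element of `SL₃(ℂ)`. -/
def mat (g : SpecialLinearGroup (Fin 3) ℂ) : Matrix (Fin 3) (Fin 3) ℂ := g

theorem mat_mul (a b : SpecialLinearGroup (Fin 3) ℂ) : mat (a * b) = mat a * mat b := rfl

theorem mat_one : mat 1 = 1 := rfl

/-- `SU(2,1)`: the matrices in `SL₃(ℂ)` with `ḡᵗ J g = J`. It carries the subspace topology. -/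
def SU21 : Subgroup (SpecialLinearGroup (Fin 3) ℂ) where
  carrier := {g | (mat g)ᴴ * J * mat g = J}
  one_mem' := by simp [mat_one]
  mul_mem' := by
    intro a b (ha : (mat a)ᴴ * J * mat a = J) (hb : (mat b)ᴴ * J * mat b = J)
    change (mat (a * b))ᴴ * J * mat (a * b) = J
    rw [mat_mul, conjTranspose_mul]
    calc _ = (mat b)ᴴ * ((mat a)ᴴ * J * mat a) * mat b := by simp only [Matrix.mul_assoc]
      _ = J := by rw [ha, hb]
  inv_mem' := by
    intro a (ha : (mat a)ᴴ * J * mat a = J)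
    change (mat a⁻¹)ᴴ * J * mat a⁻¹ = J
    have h : mat a * mat a⁻¹ = 1 := by rw [← mat_mul, mul_inv_cancel, mat_one]
    have h' := congrArg conjTranspose h
    rw [conjTranspose_mul, conjTranspose_one] at h'
    calc (mat a⁻¹)ᴴ * J * mat a⁻¹ = (mat a⁻¹)ᴴ * ((mat a)ᴴ * J * mat a) * mat a⁻¹ := by rw [ha]
      _ = ((mat a⁻¹)ᴴ * (mat a)ᴴ) * J * (mat a * mat a⁻¹) := by simp only [Matrix.mul_assoc]
      _ = J := by rw [h, h', Matrix.one_mul, Matrix.mul_one]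

/-- The vector `(τ₁, τ₂, 1)`. -/
def homVec (τ : Fin 2 → ℂ) : Fin 3 → ℂ := ![τ 0, τ 1, 1]

/-- The symmetric space `{τ ∈ ℂ² : ⟨(τ,1), (τ,1)⟩ < 0}` (the value of the form is real). -/
def Dom : Set (Fin 2 → ℂ) := {τ | (herm (homVec τ) (homVec τ)).re < 0}

/-- `j(g, τ) = C τ + D`, where `(C D)` is the bottom row of `g`. -/
def j (g : SU21) (τ : Fin 2 → ℂ) : ℂ := mat g 2 0 * τ 0 + mat g 2 1 * τ 1 + mat g 2 2

/-- The vector `(A τ + B) / (C τ + D)`. -/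
def actVec (g : SU21) (τ : Fin 2 → ℂ) : Fin 2 → ℂ :=
  ![(mat g 0 0 * τ 0 + mat g 0 1 * τ 1 + mat g 0 2) / j g τ,
    (mat g 1 0 * τ 0 + mat g 1 1 * τ 1 + mat g 1 2) / j g τ]

theorem herm_self_re (v : Fin 3 → ℂ) :
    (herm v v).re = 2 * ((v 0).re * (v 2).re + (v 0).im * (v 2).im) + normSq (v 1) := by
  simp only [herm, J, dotProduct, mulVec, Fin.sum_univ_three, Pi.star_apply, RCLike.star_def,
    normSq_apply]
  simp
  ring

theorem herm_mat (g : SU21) (v : Fin 3 → ℂ) :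
    herm (mat g *ᵥ v) (mat g *ᵥ v) = herm v v := by
  have hg : (mat g)ᴴ * J * mat g = J := g.2
  unfold herm
  rw [star_mulVec, ← dotProduct_mulVec, mulVec_mulVec, mulVec_mulVec, hg]

theorem mat_mulVec_homVec (g : SU21) (τ : Fin 2 → ℂ) : (mat g *ᵥ homVec τ) 2 = j g τ := by
  simp [mulVec, dotProduct, Fin.sum_univ_three, homVec, j]

theorem j_ne_zero (g : SU21) {τ : Fin 2 → ℂ} (hτ : τ ∈ Dom) : j g τ ≠ 0 := by
  intro h0
  have h : (herm (mat g *ᵥ homVec τ) (mat g *ᵥ homVec τ)).re < 0 := by rw [herm_mat]; exact hτ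
  rw [herm_self_re, mat_mulVec_homVec, h0] at h
  have := normSq_nonneg ((mat g *ᵥ homVec τ) 1)
  simp at h
  linarith

theorem actVec_mem (g : SU21) {τ : Fin 2 → ℂ} (hτ : τ ∈ Dom) : actVec g τ ∈ Dom := by
  have hj := j_ne_zero g hτ
  have h : (herm (mat g *ᵥ homVec τ) (mat g *ᵥ homVec τ)).re < 0 := by rw [herm_mat]; exact hτ
  have hv : mat g *ᵥ homVec τ = j g τ • homVec (actVec g τ) := by
    ext i
    fin_cases i
    · simp [mulVec, dotProduct, Fin.sum_univ_three, homVec, actVec, mul_div_cancel₀ _ hj]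
    · simp [mulVec, dotProduct, Fin.sum_univ_three, homVec, actVec, mul_div_cancel₀ _ hj]
    · simp [mulVec, dotProduct, Fin.sum_univ_three, homVec, j]
  have hs : herm (j g τ • homVec (actVec g τ)) (j g τ • homVec (actVec g τ))
      = (normSq (j g τ) : ℂ) * herm (homVec (actVec g τ)) (homVec (actVec g τ)) := by
    unfold herm
    rw [star_smul, mulVec_smul, smul_dotProduct, dotProduct_smul, normSq_eq_conj_mul_self]
    simp [smul_eq_mul, mul_assoc]
  rw [hv, hs, re_ofReal_mul] at h
  exact (pos_iff_neg_of_mul_neg h).1 (normSq_pos.2 hj)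

/-- The action `g * τ = (A τ + B) / (C τ + D)` on the symmetric space. -/
def act (g : SU21) (τ : Dom) : Dom := ⟨actVec g τ, actVec_mem g τ.2⟩

/-! ### The branch of `log j` and the function `σ` -/

/-- For bottom row `(a, b, c)`: `X(g) = -a` if `a ≠ 0`, and `X(g) = c` if `a = 0`. -/
def X (g : SU21) : ℂ := if mat g 2 0 ≠ 0 then -mat g 2 0 else mat g 2 2

/-- `j̃(g, τ) = log (j(g, τ) / X(g)) + log X(g)`, with the principal logarithm. -/
def logJ (g : SU21) (τ : Dom) : ℂ := Complex.log (j g τ / X g) + Complex.log (X g)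

/-- `(j̃(gh, τ) - j̃(g, h * τ) - j̃(h, τ)) / (2πi)`, as a complex number. -/
def sigmaAt (g h : SU21) (τ : Dom) : ℂ :=
  1 / (2 * Real.pi * I) * (logJ (g * h) τ - logJ g (act h τ) - logJ h τ)

/-- The point `(-1, 0)` of the symmetric space. -/
def basePoint : Dom := ⟨![-1, 0], by
  simp only [Dom, Set.mem_ofPred_eq, herm_self_re]
  simp [homVec]⟩

/-- The integer `σ(g, h)`: the value of `sigmaAt g h`, read off at one point and converted to an
integer. That `sigmaAt g h τ` equals this integer at every `τ` is part of the theorem. -/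
def sigma (g h : SU21) : ℤ := round (sigmaAt g h basePoint).re

/-! ### Measurable cohomology in degree two, with trivial coefficients `ℤ` -/

section Cohomology

variable (G : Type*) [Group G] [TopologicalSpace G]

/-- Inhomogeneous Borel measurable 2-cocycles `G × G → ℤ`. -/
def Z2meas : AddSubgroup (G → G → ℤ) where
  carrier := {c | Measurable[borel (G × G)] (fun p : G × G => c p.1 p.2) ∧
    ∀ g₁ g₂ g₃ : G, c g₁ g₂ + c (g₁ * g₂) g₃ = c g₁ (g₂ * g₃) + c g₂ g₃}
  zero_mem' := ⟨@measurable_const _ _ _ (borel (G × G)) 0, by simp⟩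
  add_mem' := by
    rintro a b ⟨ha, ha'⟩ ⟨hb, hb'⟩
    refine ⟨?_, fun g₁ g₂ g₃ => ?_⟩
    · let _ : MeasurableSpace (G × G) := borel (G × G)
      exact Measurable.add ha hb
    · have h₁ := ha' g₁ g₂ g₃
      have h₂ := hb' g₁ g₂ g₃
      simp only [Pi.add_apply]
      linarith
  neg_mem' := by
    rintro a ⟨ha, ha'⟩
    refine ⟨?_, fun g₁ g₂ g₃ => ?_⟩
    · let _ : MeasurableSpace (G × G) := borel (G × G)
      exact Measurable.neg ha
    · have h₁ := ha' g₁ g₂ g₃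
      simp only [Pi.neg_apply]
      linarith

/-- Coboundaries `(g, h) ↦ f g + f h - f (g h)` of Borel measurable functions `f : G → ℤ`. -/
def B2meas : AddSubgroup (G → G → ℤ) where
  carrier := {c | ∃ f : G → ℤ, Measurable[borel G] f ∧ ∀ g h : G, c g h = f g + f h - f (g * h)}
  zero_mem' := ⟨0, @measurable_const _ _ _ (borel G) 0, by simp⟩
  add_mem' := by
    rintro a b ⟨f, hf, hf'⟩ ⟨k, hk, hk'⟩
    refine ⟨f + k, ?_, fun g h => ?_⟩
    · let _ : MeasurableSpace G := borel G
      exact Measurable.add hf hk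
    · simp only [Pi.add_apply, hf', hk']
      ring
  neg_mem' := by
    rintro a ⟨f, hf, hf'⟩
    refine ⟨-f, ?_, fun g h => ?_⟩
    · let _ : MeasurableSpace G := borel G
      exact Measurable.neg hf
    · simp only [Pi.neg_apply, hf']
      ring

/-- The measurable cohomology group `H²_meas(G, ℤ)`. -/
abbrev H2meas : Type _ := Z2meas G ⧸ (B2meas G).addSubgroupOf (Z2meas G)

variable {G}

/-- The class in `H²_meas(G, ℤ)` of a measurable 2-cocycle. -/
def H2meas.mk (c : Z2meas G) : H2meas G := QuotientAddGroup.mk c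

end Cohomology

/-! ### Central extensions and universal covers of topological groups -/

/-- A topological central extension `1 → ℤ → E → G → 1`: a central group extension in which
`ℤ → E` is a closed embedding and `E → G` is a quotient map of topological groups. -/
structure TopCentralExtension (E G : Type*) [Group E] [TopologicalSpace E]
    [Group G] [TopologicalSpace G] extends GroupExtension (Multiplicative ℤ) E G where
  central : ∀ (n : Multiplicative ℤ) (e : E), inl n * e = e * inl n
  isClosedEmbedding_inl : IsClosedEmbedding inl
  isOpenQuotientMap_rightHom : IsOpenQuotientMap rightHom

/-- `κ ∈ H²_meas(G, ℤ)` is the class of the extension: it is represented by the cocycle `c` with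
`s(g) s(h) = c(g, h) s(gh)` for a Borel measurable section `s : G → E`. -/
def TopCentralExtension.HasClass {E G : Type*} [Group E] [TopologicalSpace E]
    [Group G] [TopologicalSpace G] (S : TopCentralExtension E G) (κ : H2meas G) : Prop :=
  ∃ s : G → E, Measurable[borel G, borel E] s ∧ (∀ g, S.rightHom (s g) = g) ∧
    ∃ c : Z2meas G,
      (∀ g h, s g * s h = S.inl (Multiplicative.ofAdd ((c : G → G → ℤ) g h)) * s (g * h)) ∧
      H2meas.mk c = κ

/-- `π : E → G` is a universal cover of the topological group `G`: a homomorphism of topological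
groups that is a covering map with `E` simply connected. -/
structure IsUniversalCover {E G : Type*} [Group E] [TopologicalSpace E]
    [Group G] [TopologicalSpace G] (π : E →* G) : Prop where
  isTopologicalGroup : IsTopologicalGroup E
  isCoveringMap : IsCoveringMap π
  surjective : Function.Surjective π
  simplyConnected : SimplyConnectedSpace E

end SU21Cover

end

open SU21Cover

/-!
The logarithms of the factor `j` form a group `LogCover`: its elements are the pairs `(g, z)` with
`exp z = j(g, o)`, where `o = (-1, 0)` is the base point. Since the symmetric space is connected and
simply connected, such a pair is the same as a continuous branch `φ` of `log j(g, ·)`, and the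
cocycle relation of `j` turns the set of these branches into a group with
`(g, φ) (h, ψ) = (gh, φ ∘ h + ψ)`. It projects to `SU(2,1)` with kernel `2πiℤ`, and
`g ↦ (g, logJ g o)` is a Borel section whose defect is, by the definition of `σ`, exactly `σ`
(once the kernel is identified with `ℤ` by `n ↦ -2πi n`). So everything reduces to three facts.

* The function `logJ g` is a continuous branch of the logarithm. The bottom row `(a, b, c)` of `g`
  is isotropic, and together with `2 Re τ₁ + |τ₂|² < 0` this puts `j / X` in the right half-plane
  (`re_j_div_X_pos`). The same bound shows that `logJ g τ - logJ g o` is the principal logarithm of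
  `j(g, τ) / j(g, o)` (`logJ_sub_and_mem_slitPlane`), hence jointly continuous in `g` and `τ`,
  although `X` is not continuous. This makes `LogCover` a topological group; the projection has
  local sections, so it is a covering map.

* `LogCover` is simply connected, because it is a retract of the product of the symmetric space,
  `ℂ² ∖ 0` and `ℝ` (`LogCover.param_coord`). By the Iwasawa decomposition every element of `SU(2,1)`
  is the product of an upper triangular matrix determined by the image of `o` and an element of the
  stabilizer of `o`, which is a copy of `U(2)`. On the stabilizer `j(·, o)` is the inverse of the
  determinant of that unitary matrix, so the choice of a logarithm unwinds `U(2)` to `S³ × ℝ`, and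
  `S³` is a retract of `ℂ² ∖ 0`. That `V ∖ 0` is simply connected for `dim V ≥ 3`
  (`simplyConnectedSpace_ne_zero`) follows by smoothing a loop: the cone over a smooth loop has
  dimension two, so it misses a ray, and the complement of a ray is contractible.

* Two universal covers of a locally path-connected group are isomorphic over it
  (`IsUniversalCover.exists_mulEquiv`), by lifting each projection through the other one. This
  carries the extension structure and the Borel section from `LogCover` to any universal cover.
-/

/-! ### Simply connected spaces -/

/-- A retract of a simply connected space is simply connected. -/
theorem simplyConnectedSpace_of_retract {X Y : Type*} [TopologicalSpace X] [TopologicalSpace Y]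
    [SimplyConnectedSpace X] {f : X → Y} {r : Y → X} (hf : Continuous f) (hr : Continuous r)
    (h : ∀ y, f (r y) = y) : SimplyConnectedSpace Y := by
  rw [simply_connected_iff_loops_nullhomotopic]
  refine ⟨(show Function.Surjective f from fun y => ⟨r y, h y⟩).pathConnectedSpace hf,
    fun y γ => ?_⟩
  obtain ⟨H⟩ := SimplyConnectedSpace.paths_homotopic (γ.map hr) (Path.refl (r y))
  exact ⟨{
    toFun := fun p => f (H p)
    continuous_toFun := by fun_prop
    map_zero_left := by intro t; simp [h]
    map_one_left := by intro t; simp [h]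
    prop' := by
      intro t x hx
      have := H.eq_fst t hx
      simp_all }⟩

instance simplyConnectedSpace_prod {X Y : Type*} [TopologicalSpace X] [TopologicalSpace Y]
    [SimplyConnectedSpace X] [SimplyConnectedSpace Y] : SimplyConnectedSpace (X × Y) := by
  rw [simply_connected_iff_loops_nullhomotopic]
  refine ⟨inferInstance, fun y γ => ?_⟩
  obtain ⟨H₁⟩ := SimplyConnectedSpace.paths_homotopic (γ.map continuous_fst) (Path.refl y.1)
  obtain ⟨H₂⟩ := SimplyConnectedSpace.paths_homotopic (γ.map continuous_snd) (Path.refl y.2)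
  exact ⟨Path.Homotopic.prodHomotopy H₁ H₂⟩

/-- The complement of a closed ray issuing from the origin is contractible, because it is
star-shaped about the opposite point. -/
theorem contractibleSpace_compl_ray {V : Type*} [NormedAddCommGroup V] [NormedSpace ℝ V] {v : V}
    (hv : v ≠ 0) : ContractibleSpace {x : V // ∀ s : ℝ, 0 ≤ s → x ≠ s • v} := by
  have hmem : ∀ s : ℝ, 0 ≤ s → -v ≠ s • v := by
    intro s hs h
    have : (s + 1) • v = 0 := by rw [add_smul, ← h]; simp
    rcases smul_eq_zero.1 this with h | h
    · linarith
    · exact hv h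
  refine StarConvex.contractibleSpace (x := -v) (s := {x : V | ∀ s : ℝ, 0 ≤ s → x ≠ s • v}) ?_
    ⟨-v, hmem⟩
  intro x hx a b ha hb hab s hs h
  rcases hb.eq_or_lt with rfl | hb
  · obtain rfl : a = 1 := by linarith
    simp at h
    exact hmem s hs (by simpa using h)
  · refine hx ((s + a) / b) (by positivity) ?_
    have : b • x = (s + a) • v := by rw [add_smul, ← h]; simp
    rw [div_eq_inv_mul, mul_smul, ← this, smul_smul, inv_mul_cancel₀ hb.ne', one_smul]

/-- A loop in `V ∖ 0` is homotopic to a smooth loop, and the cone over a smooth loop has dimension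
two, so it misses a ray once `dim V ≥ 3`; the complement of a ray is contractible. -/
theorem simplyConnectedSpace_ne_zero {V : Type*} [NormedAddCommGroup V] [NormedSpace ℝ V]
    [FiniteDimensional ℝ V] (hV : 2 < Module.finrank ℝ V) :
    SimplyConnectedSpace {x : V // x ≠ 0} := by
  rw [simply_connected_iff_loops_nullhomotopic]
  constructor
  · have : IsPathConnected ({0}ᶜ : Set V) :=
      isPathConnected_compl_singleton_of_one_lt_rank (by
        rw [← Module.finrank_eq_rank]; exact_mod_cast (by omega)) 0
    exact isPathConnected_iff_pathConnectedSpace.1 this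
  rintro ⟨x₀, hx₀⟩ γ
  -- the loop avoids a ball about the origin
  obtain ⟨δ, hδ, hγ⟩ : ∃ δ : ℝ, 0 < δ ∧ ∀ t : unitInterval, δ ≤ ‖(γ t : V)‖ := by
    have hc : Continuous fun t : unitInterval => ‖(γ t : V)‖ := by fun_prop
    obtain ⟨t₀, -, ht₀⟩ := isCompact_univ.exists_isMinOn Set.univ_nonempty hc.continuousOn
    exact ⟨‖(γ t₀ : V)‖, norm_pos_iff.2 (γ t₀).2, fun t => ht₀ (Set.mem_univ t)⟩
  let c : ℝ → V := fun t => (γ.extend t : V)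
  have hc : Continuous c := continuous_subtype_val.comp γ.continuous_extend
  obtain ⟨q, hq, hqc, -⟩ := hc.exists_contDiff_approx 1 (ε := fun _ => δ / 4) continuous_const
    (fun _ => by positivity)
  -- an affine correction makes the smooth approximation start and end at the base point
  let p : ℝ → V := fun t => q t + (1 - t) • (x₀ - q 0) + t • (x₀ - q 1)
  have hp : ContDiff ℝ 1 p := by
    have : ContDiff ℝ 1 q := hq
    fun_prop
  have hc0 : c 0 = x₀ := by simp [c]
  have hc1 : c 1 = x₀ := by simp [c]
  have hp0 : p 0 = x₀ := by simp [p]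
  have hp1 : p 1 = x₀ := by simp [p]
  have hpc : ∀ t : unitInterval, ‖p t - γ t‖ < δ := by
    intro t
    have h0 := hqc 0
    have h1 := hqc 1
    have ht := hqc t
    have hct : c t = γ t := by simp [c]
    rw [dist_eq_norm] at h0 h1 ht
    rw [hc0, norm_sub_rev] at h0
    rw [hc1, norm_sub_rev] at h1
    rw [hct] at ht
    have e : p t - γ t = (q t - γ t) + (1 - (t : ℝ)) • (x₀ - q 0) + (t : ℝ) • (x₀ - q 1) := by
      simp only [p]; abel
    have a0 : ‖(1 - (t : ℝ)) • (x₀ - q 0)‖ ≤ ‖x₀ - q 0‖ := by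
      rw [norm_smul, Real.norm_of_nonneg (by linarith [t.2.2])]
      exact mul_le_of_le_one_left (norm_nonneg _) (by linarith [t.2.1])
    have a1 : ‖(t : ℝ) • (x₀ - q 1)‖ ≤ ‖x₀ - q 1‖ := by
      rw [norm_smul, Real.norm_of_nonneg t.2.1]
      exact mul_le_of_le_one_left (norm_nonneg _) t.2.2
    rw [e]
    refine (norm_add₃_le).trans_lt ?_
    linarith
  have hseg : ∀ s t : unitInterval, (γ t : V) + (s : ℝ) • (p t - γ t) ≠ 0 := by
    intro s t h
    have h1 : (γ t : V) = -((s : ℝ) • (p t - γ t)) := eq_neg_of_add_eq_zero_left h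
    have h2 := hγ t
    rw [h1, norm_neg, norm_smul, Real.norm_of_nonneg s.2.1] at h2
    have := mul_le_of_le_one_left (norm_nonneg (p t - γ t)) s.2.2
    linarith [hpc t]
  have hpne : ∀ t : unitInterval, p t ≠ 0 := by
    intro t h
    have := hseg 1 t
    simp [h] at this
  -- the cone over the smooth loop misses a direction `v`
  obtain ⟨v, hv⟩ : ∃ v : V, v ∉ Set.range (fun z : ℝ × ℝ => z.1 • p z.2) := by
    have hd : Dense (Set.range (fun z : ℝ × ℝ => z.1 • p z.2))ᶜ := by
      apply ContDiff.dense_compl_range_of_finrank_lt_finrank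
      · fun_prop
      · simpa using hV
    exact hd.nonempty
  have hv0 : v ≠ 0 := by
    rintro rfl
    exact hv ⟨(0, 0), by simp⟩
  have hray : ∀ (t : unitInterval) (s : ℝ), 0 ≤ s → p t ≠ s • v := by
    intro t s _ h
    have hs : s ≠ 0 := by
      rintro rfl
      exact hpne t (by simpa using h)
    exact hv ⟨(s⁻¹, t), by simp [h, smul_smul, inv_mul_cancel₀ hs]⟩
  have hpcont : Continuous p := hp.continuous
  let P : Path (⟨x₀, hx₀⟩ : {x : V // x ≠ 0}) ⟨x₀, hx₀⟩ :=
    { toFun := fun t => ⟨p t, hpne t⟩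
      continuous_toFun := by fun_prop
      source' := by simp [hp0]
      target' := by simp [hp1] }
  have H₁ : Path.Homotopic γ P := ⟨{
    toFun := fun z => ⟨(γ z.2 : V) + (z.1 : ℝ) • (p z.2 - γ z.2), hseg z.1 z.2⟩
    continuous_toFun := by fun_prop
    map_zero_left := by intro t; simp
    map_one_left := by intro t; simp [P]
    prop' := by
      intro t x hx
      rcases hx with rfl | rfl
      · simp [hp0]
      · simp [hp1] }⟩
  have hR : ContractibleSpace {x : V // ∀ s : ℝ, 0 ≤ s → x ≠ s • v} :=
    contractibleSpace_compl_ray hv0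
  have hx₀R : ∀ s : ℝ, 0 ≤ s → x₀ ≠ s • v := by
    intro s hs; rw [← hp0]; exact hray 0 s hs
  let Q : Path (⟨x₀, hx₀R⟩ : {x : V // ∀ s : ℝ, 0 ≤ s → x ≠ s • v}) ⟨x₀, hx₀R⟩ :=
    { toFun := fun t => ⟨p t, hray t⟩
      continuous_toFun := by fun_prop
      source' := by simp [hp0]
      target' := by simp [hp1] }
  let incl : C({x : V // ∀ s : ℝ, 0 ≤ s → x ≠ s • v}, {x : V // x ≠ 0}) :=
    ⟨fun x => ⟨x, fun h => x.2 0 le_rfl (by simp [h])⟩, by fun_prop⟩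
  have H₂ := (SimplyConnectedSpace.paths_homotopic Q (Path.refl _)).map incl
  exact H₁.trans H₂

/-! ### The branch of `log j` and the cocycle `σ` -/

namespace SU21Cover

theorem J_mul_J : J * J = 1 := by
  ext i k
  fin_cases i <;> fin_cases k <;> simp [J, Matrix.mul_apply, Fin.sum_univ_three]

theorem mat_conj (g : SU21) : (mat g)ᴴ * J * mat g = J := g.2

/-- The defining identity `ḡᵗ J g = J` concerns the columns of `g`; this is the one for the rows. -/
theorem mat_J_conj (g : SU21) : mat g * J * (mat g)ᴴ = J := by
  have h : (J * (mat g)ᴴ * J) * mat g = 1 := by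
    rw [Matrix.mul_assoc J, Matrix.mul_assoc J, mat_conj, J_mul_J]
  have h' : mat g * (J * (mat g)ᴴ * J) = 1 := mul_eq_one_comm.1 h
  calc mat g * J * (mat g)ᴴ = mat g * (J * (mat g)ᴴ * J) * J := by
        simp only [Matrix.mul_assoc, J_mul_J, Matrix.mul_one]
    _ = J := by rw [h', Matrix.one_mul]

/-- The bottom row of an element of `SU(2,1)` is isotropic. -/
theorem bottom_row_isotropic (g : SU21) :
    2 * ((mat g 2 0).re * (mat g 2 2).re + (mat g 2 0).im * (mat g 2 2).im)
      + normSq (mat g 2 1) = 0 := by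
  have h := congrFun (congrFun (mat_J_conj g) 2) 2
  have h' := congrArg Complex.re h
  simp [J, Matrix.mul_apply, Fin.sum_univ_three] at h'
  rw [normSq_apply]
  linarith

theorem mem_Dom_iff (τ : Fin 2 → ℂ) : τ ∈ Dom ↔ 2 * (τ 0).re + normSq (τ 1) < 0 := by
  simp [Dom, herm_self_re, homVec]

theorem bottom_row_of_eq_zero (g : SU21) (h : mat g 2 0 = 0) : mat g 2 1 = 0 ∧ mat g 2 2 ≠ 0 := by
  have h1 : mat g 2 1 = 0 := by
    have := bottom_row_isotropic g
    simp [h] at this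
    exact this
  refine ⟨h1, fun h2 => ?_⟩
  have := j_ne_zero g basePoint.2
  simp [j, h, h1, h2] at this

theorem X_ne_zero (g : SU21) : X g ≠ 0 := by
  unfold X
  split_ifs with h
  · exact neg_ne_zero.2 h
  · exact (bottom_row_of_eq_zero g (not_not.1 h)).2

/-- The quotient `j / X` takes values in the right half-plane, which makes the principal logarithm
continuous along it. For `a ≠ 0` this is the inequality of arithmetic and geometric means together
with the isotropy of the bottom row. -/
theorem re_j_div_X_pos (g : SU21) {τ : Fin 2 → ℂ} (hτ : τ ∈ Dom) : 0 < (j g τ / X g).re := by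
  unfold X
  split_ifs with h
  · rw [mem_Dom_iff] at hτ
    have hi := bottom_row_isotropic g
    set a := mat g 2 0
    set b := mat g 2 1
    set c := mat g 2 2
    have ha : 0 < normSq a := normSq_pos.2 h
    have e : j g τ / -a = -((j g τ * (starRingEnd ℂ) a) / (normSq a : ℂ)) := by
      rw [normSq_eq_conj_mul_self, div_neg]
      have : (starRingEnd ℂ) a ≠ 0 := by simpa using h
      field_simp
    rw [e, neg_re, neg_pos, div_ofReal_re]
    refine div_neg_of_neg_of_pos ?_ ha
    have e2 : (j g τ * (starRingEnd ℂ) a).re = normSq a * (τ 0).re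
        + (b * τ 1 * (starRingEnd ℂ) a).re + (a.re * c.re + a.im * c.im) := by
      simp only [j, add_mul, add_re, mul_re, mul_im, conj_re, conj_im, normSq_apply]
      ring
    rw [e2]
    -- `2 Re (b τ₂ ā) ≤ |b|² + |a τ₂|²`
    have e3 : 2 * (b * τ 1 * (starRingEnd ℂ) a).re ≤ normSq b + normSq a * normSq (τ 1) := by
      have := normSq_nonneg (b - (starRingEnd ℂ) (τ 1) * a)
      simp only [normSq_apply, sub_re, sub_im, mul_re, mul_im, conj_re, conj_im] at this ⊢
      nlinarith
    nlinarith
  · have h0 := not_not.1 h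
    obtain ⟨h1, h2⟩ := bottom_row_of_eq_zero g h0
    simp [j, h0, h1, div_self h2]

theorem continuous_Dom_apply (i : Fin 2) : Continuous fun τ : Dom => (τ : Fin 2 → ℂ) i :=
  (continuous_apply i).comp continuous_subtype_val

theorem continuous_mat_apply (i k : Fin 3) : Continuous fun g : SU21 => mat g i k := by
  have : Continuous fun g : SU21 => mat g :=
    continuous_subtype_val.comp continuous_subtype_val
  exact this.matrix_elem i k

/-- Joint continuity of the linear forms given by the rows of a matrix in the group. -/
theorem continuous_row (i : Fin 3) : Continuous fun p : SU21 × Dom =>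
    mat p.1 i 0 * (p.2 : Fin 2 → ℂ) 0 + mat p.1 i 1 * (p.2 : Fin 2 → ℂ) 1 + mat p.1 i 2 :=
  ((((continuous_mat_apply i 0).comp continuous_fst).mul
    ((continuous_Dom_apply 0).comp continuous_snd)).add
    (((continuous_mat_apply i 1).comp continuous_fst).mul
    ((continuous_Dom_apply 1).comp continuous_snd))).add
    ((continuous_mat_apply i 2).comp continuous_fst)

theorem continuous_j : Continuous fun p : SU21 × Dom => j p.1 p.2 := continuous_row 2

theorem exp_logJ (g : SU21) (τ : Dom) : exp (logJ g τ) = j g τ := by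
  have h : j g τ / X g ≠ 0 := div_ne_zero (j_ne_zero g τ.2) (X_ne_zero g)
  rw [logJ, exp_add, exp_log h, exp_log (X_ne_zero g), div_mul_cancel₀ _ (X_ne_zero g)]

theorem continuous_logJ (g : SU21) : Continuous (logJ g) := by
  unfold logJ
  refine Continuous.add (Continuous.clog ?_ fun τ => Or.inl (re_j_div_X_pos g τ.2))
    continuous_const
  exact (continuous_j.comp (Continuous.prodMk_right g)).div_const _

theorem convex_Dom : Convex ℝ Dom := by
  intro x hx y hy a b ha hb hab
  rw [mem_Dom_iff] at *
  simp only [Pi.add_apply, Pi.smul_apply, normSq_apply, add_re, add_im, smul_re, smul_im,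
    smul_eq_mul] at *
  have hb' : b = 1 - a := by linarith
  have : 0 ≤ a * b * (((x 1).re - (y 1).re) ^ 2 + ((x 1).im - (y 1).im) ^ 2) := by positivity
  rcases ha.eq_or_lt with rfl | ha
  · obtain rfl : b = 1 := by linarith
    simpa using hy
  · have h1 := mul_neg_of_pos_of_neg ha hx
    have h2 := mul_nonpos_of_nonneg_of_nonpos hb hy.le
    subst hb'
    nlinarith

instance : ContractibleSpace Dom := convex_Dom.contractibleSpace ⟨_, basePoint.2⟩

theorem act_homVec (g : SU21) (τ : Dom) :
    mat g *ᵥ homVec τ = j g τ • homVec (act g τ : Fin 2 → ℂ) := by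
  have hj := j_ne_zero g τ.2
  ext i
  fin_cases i
  · simp [mulVec, dotProduct, Fin.sum_univ_three, homVec, act, actVec, mul_div_cancel₀ _ hj]
  · simp [mulVec, dotProduct, Fin.sum_univ_three, homVec, act, actVec, mul_div_cancel₀ _ hj]
  · simp [mulVec, dotProduct, Fin.sum_univ_three, homVec, j]

theorem j_mul (g h : SU21) (τ : Dom) : j (g * h) τ = j g (act h τ) * j h τ := by
  rw [← mat_mulVec_homVec, ← mat_mulVec_homVec g]
  have : mat (g * h : SU21) = mat g * mat h := rfl
  rw [this, ← mulVec_mulVec, act_homVec, mulVec_smul, Pi.smul_apply, smul_eq_mul, mul_comm]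

theorem homVec_injective : Function.Injective homVec := by
  intro x y h
  have h0 := congrFun h 0
  have h1 := congrFun h 1
  simp [homVec] at h0 h1
  ext i
  fin_cases i <;> simp [h0, h1]

theorem act_mul (g h : SU21) (τ : Dom) : act (g * h) τ = act g (act h τ) := by
  apply Subtype.ext
  apply homVec_injective
  have h1 := act_homVec (g * h) τ
  have : mat (g * h : SU21) = mat g * mat h := rfl
  rw [this, ← mulVec_mulVec, act_homVec, mulVec_smul, act_homVec, j_mul, smul_smul,
    mul_comm (j h _)] at h1
  exact (smul_right_injective _ (mul_ne_zero (j_ne_zero g (act h τ).2) (j_ne_zero h τ.2)) h1).symm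

theorem act_one (τ : Dom) : act 1 τ = τ := by
  apply Subtype.ext
  ext i
  fin_cases i <;> simp [act, actVec, j, mat_one]

theorem j_one (τ : Fin 2 → ℂ) : j 1 τ = 1 := by simp [j, mat_one]

theorem continuous_act_uncurry : Continuous fun p : SU21 × Dom => act p.1 p.2 := by
  unfold act actVec
  refine Continuous.subtype_mk (continuous_pi fun i => ?_) _
  fin_cases i
  · exact (continuous_row 0).div continuous_j fun p => j_ne_zero p.1 p.2.2
  · exact (continuous_row 1).div continuous_j fun p => j_ne_zero p.1 p.2.2

theorem continuous_act (h : SU21) : Continuous (act h) := by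
  have := continuous_act_uncurry.comp (Continuous.prodMk_right h)
  exact this

theorem continuous_sigmaAt (g h : SU21) : Continuous (sigmaAt g h) := by
  unfold sigmaAt
  exact continuous_const.mul (((continuous_logJ _).sub
    ((continuous_logJ g).comp (continuous_act h))).sub (continuous_logJ h))

theorem exists_int_sigmaAt (g h : SU21) (τ : Dom) : ∃ n : ℤ, sigmaAt g h τ = n := by
  have h1 : exp (logJ (g * h) τ - logJ g (act h τ) - logJ h τ) = 1 := by
    rw [exp_sub, exp_sub, exp_logJ, exp_logJ, exp_logJ, j_mul]
    have := j_ne_zero g (act h τ).2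
    have := j_ne_zero h τ.2
    field_simp
  obtain ⟨n, hn⟩ := exp_eq_one_iff.1 h1
  refine ⟨n, ?_⟩
  rw [sigmaAt, hn]
  have := two_pi_I_ne_zero
  field_simp

theorem sigma_eq (g h : SU21) (τ : Dom) : (sigma g h : ℂ) = sigmaAt g h τ := by
  choose n hn using exists_int_sigmaAt g h
  have hc : Continuous n := by
    rw [Int.isClosedEmbedding_coe_real.isInducing.continuous_iff]
    have : Int.cast ∘ n = fun τ => (sigmaAt g h τ).re := by ext τ; simp [hn]
    rw [this]
    exact continuous_re.comp (continuous_sigmaAt g h)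
  have := PreconnectedSpace.constant (inferInstance : PreconnectedSpace Dom) hc (x := τ)
    (y := basePoint)
  rw [hn τ, sigma, hn basePoint, this]
  simp

theorem logJ_mul (g h : SU21) (τ : Dom) :
    logJ (g * h) τ = logJ g (act h τ) + logJ h τ + 2 * Real.pi * I * sigma g h := by
  rw [sigma_eq g h τ, sigmaAt]
  have := two_pi_I_ne_zero
  field_simp
  ring

theorem sigma_cocycle (g₁ g₂ g₃ : SU21) :
    sigma g₁ g₂ + sigma (g₁ * g₂) g₃ = sigma g₁ (g₂ * g₃) + sigma g₂ g₃ := by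
  have h : (2 * Real.pi * I : ℂ) * (sigma g₁ g₂ + sigma (g₁ * g₂) g₃ : ℤ)
      = (2 * Real.pi * I : ℂ) * (sigma g₁ (g₂ * g₃) + sigma g₂ g₃ : ℤ) := by
    have h1 := logJ_mul g₁ g₂ (act g₃ basePoint)
    have h2 := logJ_mul (g₁ * g₂) g₃ basePoint
    have h3 := logJ_mul g₁ (g₂ * g₃) basePoint
    have h4 := logJ_mul g₂ g₃ basePoint
    rw [act_mul, ← mul_assoc] at h3
    push_cast
    linear_combination h3 + h4 - h1 - h2
  exact_mod_cast mul_left_cancel₀ two_pi_I_ne_zero h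

theorem measurable_X : Measurable[borel SU21] X := by
  let _ : MeasurableSpace SU21 := borel SU21
  have : BorelSpace SU21 := ⟨rfl⟩
  unfold X
  refine Measurable.ite ?_ ?_ ?_
  · exact ((continuous_mat_apply 2 0).measurable (measurableSet_singleton 0)).compl
  · exact (continuous_mat_apply 2 0).measurable.neg
  · exact (continuous_mat_apply 2 2).measurable

/-- `logJ` is Borel measurable in the group element when the point depends continuously on a
parameter. -/
theorem measurable_logJ_comp {A : Type*} [TopologicalSpace A] {g : A → SU21} {τ : A → Dom}
    (hg : Continuous g) (hτ : Continuous τ) :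
    Measurable[borel A] fun x => logJ (g x) (τ x) := by
  let _ : MeasurableSpace A := borel A
  have : BorelSpace A := ⟨rfl⟩
  let _ : MeasurableSpace SU21 := borel SU21
  have : BorelSpace SU21 := ⟨rfl⟩
  have hX : Measurable fun x => X (g x) := measurable_X.comp hg.measurable
  have hj : Measurable fun x => j (g x) (τ x) := (continuous_j.comp (hg.prodMk hτ)).measurable
  exact ((hj.div hX).clog).add hX.clog

theorem measurable_sigma :
    Measurable[borel (SU21 × SU21)] fun p : SU21 × SU21 => sigma p.1 p.2 := by
  let _ : MeasurableSpace (SU21 × SU21) := borel (SU21 × SU21)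
  have h1 : Measurable fun p : SU21 × SU21 => logJ (p.1 * p.2) basePoint :=
    measurable_logJ_comp continuous_mul continuous_const
  have c2 : Continuous fun p : SU21 × SU21 => act p.2 basePoint := by
    have := continuous_act_uncurry.comp
      ((Continuous.prodMk_left basePoint).comp (continuous_snd (X := SU21) (Y := SU21)))
    exact this
  have h2 : Measurable fun p : SU21 × SU21 => logJ p.1 (act p.2 basePoint) :=
    measurable_logJ_comp continuous_fst c2
  have h3 : Measurable fun p : SU21 × SU21 => logJ p.2 basePoint :=
    measurable_logJ_comp continuous_snd continuous_const
  have h4 : Measurable fun p : SU21 × SU21 => sigmaAt p.1 p.2 basePoint :=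
    ((h1.sub h2).sub h3).const_mul (1 / (2 * Real.pi * I))
  have h5 : Measurable fun p : SU21 × SU21 => (sigmaAt p.1 p.2 basePoint).re :=
    measurable_re.comp h4
  have h6 : Measurable fun x : ℝ => round x := by
    simp_rw [round_eq]
    exact Int.measurable_floor.comp (measurable_id.add_const _)
  exact h6.comp h5

theorem sigma_mem : sigma ∈ Z2meas SU21 := ⟨measurable_sigma, sigma_cocycle⟩

end SU21Cover

/-! ### The covering group of logarithms of `j` -/

noncomputable section

namespace SU21Cover

/-- The difference of two values of the branch `logJ g`, in a form that does not involve the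
discontinuous function `X`. -/
def logRatio (g : SU21) (τ : Dom) : ℂ := log (j g τ / j g basePoint)

/-- Two values of `j / X` lie in the right half-plane, so their arguments differ by less than `π`
and the principal logarithm of their quotient is the difference of the logarithms. -/
theorem logJ_sub_and_mem_slitPlane (g : SU21) (τ : Dom) :
    logJ g τ - logJ g basePoint = logRatio g τ ∧ j g τ / j g basePoint ∈ slitPlane := by
  have hu := re_j_div_X_pos g τ.2
  have hv := re_j_div_X_pos g basePoint.2
  set u := j g τ / X g with hu'
  set v := j g basePoint / X g with hv'
  have hu0 : u ≠ 0 := by rintro h; simp [h] at hu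
  have hv0 : v ≠ 0 := by rintro h; simp [h] at hv
  have au := abs_lt.1 (abs_arg_lt_pi_div_two_iff.2 (Or.inl hu))
  have av := abs_lt.1 (abs_arg_lt_pi_div_two_iff.2 (Or.inl hv))
  have huv : u / v = j g τ / j g basePoint := by
    rw [hu', hv', div_div_div_cancel_right₀ (X_ne_zero g)]
  have hexp : exp (log u - log v) = u / v := by rw [exp_sub, exp_log hu0, exp_log hv0]
  have him : (log u - log v).im = arg u - arg v := by simp [log_im]
  have hlog : log (u / v) = log u - log v := by
    rw [← hexp]
    apply log_exp <;> rw [him] <;> linarith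
  refine ⟨?_, ?_⟩
  · rw [logRatio, ← huv, hlog, logJ, logJ]
    ring
  · rw [← huv, mem_slitPlane_iff_arg]
    refine ⟨?_, div_ne_zero hu0 hv0⟩
    rw [← log_im, hlog, him]
    intro h
    linarith

theorem logJ_sub_basePoint (g : SU21) (τ : Dom) :
    logJ g τ - logJ g basePoint = logRatio g τ := (logJ_sub_and_mem_slitPlane g τ).1

theorem continuous_j_basePoint : Continuous fun g : SU21 => j g basePoint := by
  have := continuous_j.comp (Continuous.prodMk_left basePoint)
  exact this

theorem continuous_logRatio : Continuous fun p : SU21 × Dom => logRatio p.1 p.2 := by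
  refine Continuous.clog ?_ fun p => (logJ_sub_and_mem_slitPlane p.1 p.2).2
  exact continuous_j.div (continuous_j_basePoint.comp continuous_fst)
    fun p => j_ne_zero p.1 basePoint.2

theorem continuous_logRatio_comp {A : Type*} [TopologicalSpace A] {g : A → SU21} {τ : A → Dom}
    (hg : Continuous g) (hτ : Continuous τ) : Continuous fun a => logRatio (g a) (τ a) := by
  have := continuous_logRatio.comp (hg.prodMk hτ)
  exact this

theorem continuous_act_comp {A : Type*} [TopologicalSpace A] {g : A → SU21} {τ : A → Dom}
    (hg : Continuous g) (hτ : Continuous τ) : Continuous fun a => act (g a) (τ a) := by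
  have := continuous_act_uncurry.comp (hg.prodMk hτ)
  exact this

theorem exp_logRatio (g : SU21) (τ : Dom) : exp (logRatio g τ) = j g τ / j g basePoint :=
  exp_log (div_ne_zero (j_ne_zero g τ.2) (j_ne_zero g basePoint.2))

theorem logRatio_one (τ : Dom) : logRatio 1 τ = 0 := by simp [logRatio, j_one]

theorem logRatio_basePoint (g : SU21) : logRatio g basePoint = 0 := by
  simp [logRatio, div_self (j_ne_zero g basePoint.2)]

theorem logRatio_mul (g h : SU21) (τ : Dom) :
    logRatio (g * h) τ = logRatio g (act h τ) - logRatio g (act h basePoint) + logRatio h τ := by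
  simp only [← logJ_sub_basePoint]
  have h1 := logJ_mul g h τ
  have h2 := logJ_mul g h basePoint
  linear_combination h1 - h2

/-- The covering group of `SU(2,1)` consisting of the pairs `(g, z)` of an element `g` and a
logarithm `z` of `j(g, ·)` at the base point. Such a pair is the same as a continuous branch of
`log j(g, ·)`, and the group law is `(g, φ) (h, ψ) = (gh, φ ∘ h + ψ)`. -/
@[ext]
structure LogCover where
  /-- The element of `SU(2,1)` below a point of the covering group. -/
  fst : SU21
  /-- The chosen logarithm of the factor `j` at the base point. -/
  snd : ℂ
  exp_snd : exp snd = j fst basePoint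

namespace LogCover

/-- The underlying pair of a group element and a complex number. -/
def toProd (x : LogCover) : SU21 × ℂ := (x.fst, x.snd)

theorem toProd_injective : Function.Injective toProd := fun _ _ h =>
  LogCover.ext (congrArg Prod.fst h) (congrArg Prod.snd h)

/-- The topology is that of a subspace of `SU(2,1) × ℂ`. -/
instance : TopologicalSpace LogCover := TopologicalSpace.induced toProd inferInstance

theorem isInducing_toProd : IsInducing toProd := ⟨rfl⟩

theorem continuous_fst : Continuous fst :=
  _root_.continuous_fst.comp isInducing_toProd.continuous

theorem continuous_snd : Continuous snd :=
  _root_.continuous_snd.comp isInducing_toProd.continuous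

theorem continuous_mk {A : Type*} [TopologicalSpace A] {g : A → SU21} {z : A → ℂ}
    (hg : Continuous g) (hz : Continuous z) (h : ∀ a, exp (z a) = j (g a) basePoint) :
    Continuous fun a => (⟨g a, z a, h a⟩ : LogCover) :=
  isInducing_toProd.continuous_iff.2 (hg.prodMk hz)

instance : Mul LogCover := ⟨fun x y =>
  ⟨x.fst * y.fst, x.snd + y.snd + logRatio x.fst (act y.fst basePoint), by
    rw [exp_add, exp_add, exp_logRatio, x.exp_snd, y.exp_snd, j_mul]
    have := j_ne_zero x.fst basePoint.2
    field_simp⟩⟩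

instance : One LogCover := ⟨⟨1, 0, by simp [j_one]⟩⟩

instance : Inv LogCover := ⟨fun x =>
  ⟨x.fst⁻¹, -x.snd - logRatio x.fst⁻¹ (act x.fst basePoint), by
    have h : j x.fst⁻¹ (act x.fst basePoint) * j x.fst basePoint = 1 := by
      rw [← j_mul, inv_mul_cancel, j_one]
    rw [exp_sub, exp_neg, exp_logRatio, x.exp_snd]
    have h1 := j_ne_zero x.fst basePoint.2
    have h2 := j_ne_zero x.fst⁻¹ (act x.fst basePoint).2
    have h3 := j_ne_zero x.fst⁻¹ basePoint.2
    field_simp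
    rw [mul_comm, h]⟩⟩

theorem mul_fst (x y : LogCover) : (x * y).fst = x.fst * y.fst := rfl
theorem mul_snd (x y : LogCover) :
    (x * y).snd = x.snd + y.snd + logRatio x.fst (act y.fst basePoint) := rfl
theorem one_fst : (1 : LogCover).fst = 1 := rfl
theorem one_snd : (1 : LogCover).snd = 0 := rfl
theorem inv_fst (x : LogCover) : x⁻¹.fst = x.fst⁻¹ := rfl
theorem inv_snd (x : LogCover) :
    x⁻¹.snd = -x.snd - logRatio x.fst⁻¹ (act x.fst basePoint) := rfl

instance : Group LogCover :=
  Group.ofLeftAxioms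
    (fun x y z => by
      ext1
      · simp only [mul_fst, mul_assoc]
      · simp only [mul_fst, mul_snd, logRatio_mul, act_mul]
        ring)
    (fun x => by
      ext1
      · simp only [mul_fst, one_fst, one_mul]
      · simp only [mul_snd, one_fst, one_snd, logRatio_one, zero_add, add_zero])
    (fun x => by
      ext1
      · simp only [mul_fst, inv_fst, one_fst, inv_mul_cancel]
      · simp only [mul_snd, inv_fst, inv_snd, one_snd]
        ring)

instance : IsTopologicalGroup LogCover where
  continuous_mul := by
    have c1 : Continuous fun p : LogCover × LogCover => p.1.fst :=
      continuous_fst.comp _root_.continuous_fst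
    have c2 : Continuous fun p : LogCover × LogCover => p.2.fst :=
      continuous_fst.comp _root_.continuous_snd
    have c3 : Continuous fun p : LogCover × LogCover => act p.2.fst basePoint :=
      continuous_act_comp c2 continuous_const
    have c4 : Continuous fun p : LogCover × LogCover =>
        logRatio p.1.fst (act p.2.fst basePoint) := continuous_logRatio_comp c1 c3
    exact continuous_mk (c1.mul c2) (((continuous_snd.comp _root_.continuous_fst).add
      (continuous_snd.comp _root_.continuous_snd)).add c4) _
  continuous_inv := by
    have c3 : Continuous fun x : LogCover => act x.fst basePoint :=
      continuous_act_comp continuous_fst continuous_const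
    have c4 : Continuous fun x : LogCover =>
        logRatio x.fst⁻¹ (act x.fst basePoint) :=
      continuous_logRatio_comp continuous_fst.inv c3
    exact continuous_mk continuous_fst.inv (continuous_snd.neg.sub c4) _

/-- The projection of the covering group to `SU(2,1)`. -/
def proj : LogCover →* SU21 where
  toFun := fst
  map_one' := rfl
  map_mul' _ _ := rfl

theorem isOpenQuotientMap_proj : IsOpenQuotientMap proj := by
  refine ⟨fun g => ⟨⟨g, logJ g basePoint, exp_logJ g basePoint⟩, rfl⟩, continuous_fst,
    IsOpenMap.of_sections fun x => ?_⟩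
  -- the section `g ↦ (g, z + log (j(g, o) / j(g₀, o)))` through the point `(g₀, z)`
  have hx := j_ne_zero x.fst basePoint.2
  refine ⟨fun g => ⟨g, x.snd + log (j g basePoint / j x.fst basePoint), ?_⟩, ?_, ?_, fun g => rfl⟩
  · rw [exp_add, exp_log (div_ne_zero (j_ne_zero g basePoint.2) hx), exp_snd,
      mul_div_cancel₀ _ hx]
  · refine isInducing_toProd.continuousAt_iff.2 ?_
    refine continuousAt_id.prodMk (continuousAt_const.add (ContinuousAt.clog ?_ ?_))
    · exact (continuous_j_basePoint.div_const _).continuousAt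
    · rw [show j (proj x) basePoint = j x.fst basePoint from rfl, div_self hx]
      exact one_mem_slitPlane
  · ext1
    · rfl
    · change x.snd + log (j x.fst basePoint / j x.fst basePoint) = x.snd
      rw [div_self hx, log_one, add_zero]

/-- The inclusion of the kernel of the projection. The sign makes the cocycle of the section
`g ↦ (g, logJ g o)` equal to `σ` rather than `-σ`. -/
def incl : Multiplicative ℤ →* LogCover where
  toFun n := ⟨1, -(2 * Real.pi * I * (n.toAdd : ℂ)), by
    rw [exp_neg, mul_comm, exp_int_mul_two_pi_mul_I, j_one, inv_one]⟩
  map_one' := by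
    ext1
    · rfl
    · change -(2 * Real.pi * I * ((0 : ℤ) : ℂ)) = 0
      simp
  map_mul' m n := by
    ext1
    · exact (mul_one 1).symm
    · rw [mul_snd]
      change -(2 * Real.pi * I * ((m.toAdd + n.toAdd : ℤ) : ℂ)) =
        -(2 * Real.pi * I * (m.toAdd : ℂ)) + -(2 * Real.pi * I * (n.toAdd : ℂ)) + logRatio 1 _
      rw [logRatio_one]
      push_cast
      ring

theorem incl_fst (n : Multiplicative ℤ) : (incl n).fst = 1 := rfl
theorem incl_snd (n : Multiplicative ℤ) : (incl n).snd = -(2 * Real.pi * I * (n.toAdd : ℂ)) := rfl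

theorem range_incl : incl.range = proj.ker := by
  ext x
  constructor
  · rintro ⟨n, rfl⟩
    rfl
  · intro hx
    have h1 : x.fst = 1 := hx
    have h2 : exp x.snd = 1 := by rw [exp_snd, h1, j_one]
    obtain ⟨n, hn⟩ := exp_eq_one_iff.1 h2
    refine ⟨Multiplicative.ofAdd (-n), ?_⟩
    ext1
    · exact h1.symm
    · rw [incl_snd, hn, toAdd_ofAdd]
      push_cast
      ring

instance : T2Space LogCover :=
  .of_injective_continuous toProd_injective isInducing_toProd.continuous

theorem isClosedEmbedding_incl : IsClosedEmbedding incl := by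
  refine ⟨IsEmbedding.of_comp continuous_of_discreteTopology continuous_snd ?_, ?_⟩
  · have h1 : IsEmbedding fun z : ℂ => -(2 * Real.pi * I * z) :=
      ((Homeomorph.mulLeft₀ _ two_pi_I_ne_zero).trans (Homeomorph.neg ℂ)).isEmbedding
    have h2 : IsEmbedding fun n : Multiplicative ℤ => ((n.toAdd : ℤ) : ℂ) := by
      have h3 := (isometry_ofReal.isEmbedding.comp Int.isClosedEmbedding_coe_real.isEmbedding)
      have e : IsEmbedding (Multiplicative.toAdd : Multiplicative ℤ → ℤ) :=
        Homeomorph.isEmbedding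
          { toEquiv := Multiplicative.toAdd
            continuous_toFun := continuous_toAdd
            continuous_invFun := continuous_ofAdd }
      simpa [Function.comp_def] using h3.comp e
    exact h1.comp h2
  · have : Set.range incl = proj ⁻¹' {1} := by
      have := congrArg (fun H : Subgroup LogCover => (H : Set LogCover)) range_incl
      exact this
    rw [this]
    exact isClosed_singleton.preimage isOpenQuotientMap_proj.continuous

theorem incl_mul_comm (n : Multiplicative ℤ) (x : LogCover) : incl n * x = x * incl n := by
  ext1
  · rw [mul_fst, mul_fst, incl_fst, one_mul, mul_one]
  · rw [mul_snd, mul_snd, incl_fst, logRatio_one, act_one, logRatio_basePoint]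
    ring

theorem isCoveringMap_proj : IsCoveringMap proj := by
  refine (isOpenQuotientMap_proj.isQuotientMap.isQuotientCoveringMap_of_isDiscrete_ker_monoidHom
    ?_).isCoveringMap
  rw [← range_incl]
  have := IsDiscrete.univ.image isClosedEmbedding_incl.isInducing
  rwa [Set.image_univ] at this

instance : SecondCountableTopology (SpecialLinearGroup (Fin 3) ℂ) :=
  by
  have : SecondCountableTopology (Matrix (Fin 3) (Fin 3) ℂ) :=
    inferInstanceAs (SecondCountableTopology (Fin 3 → Fin 3 → ℂ))
  exact TopologicalSpace.Subtype.secondCountableTopology _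

/-- The section `g ↦ (g, logJ g o)`. -/
def sec (g : SU21) : LogCover := ⟨g, logJ g basePoint, exp_logJ g basePoint⟩

instance : SecondCountableTopology SU21 :=
  TopologicalSpace.Subtype.secondCountableTopology _

theorem measurable_sec : Measurable[borel SU21, borel LogCover] sec := by
  let _ : MeasurableSpace SU21 := borel SU21
  have : BorelSpace SU21 := ⟨rfl⟩
  have h1 : Measurable fun g : SU21 => (g, logJ g basePoint) :=
    measurable_id.prodMk (measurable_logJ_comp continuous_id continuous_const)
  have h2 : borel LogCover = MeasurableSpace.comap toProd
      (inferInstance : MeasurableSpace (SU21 × ℂ)) := by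
    rw [BorelSpace.measurable_eq (α := SU21 × ℂ), ← borel_comap]
  rw [h2]
  exact measurable_comap_iff.2 h1

theorem sec_mul_sec (g h : SU21) :
    sec g * sec h = incl (Multiplicative.ofAdd (sigma g h)) * sec (g * h) := by
  ext1
  · rw [mul_fst, mul_fst, incl_fst, one_mul]
    rfl
  · rw [mul_snd, mul_snd, incl_fst, incl_snd, logRatio_one]
    change logJ g basePoint + logJ h basePoint + logRatio g (act h basePoint) =
      -(2 * Real.pi * I * sigma g h) + logJ (g * h) basePoint + 0
    rw [← logJ_sub_basePoint, logJ_mul]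
    ring

end LogCover
end SU21Cover

end

/-! ### The Iwasawa decomposition of `SU(2,1)` -/

noncomputable section
namespace SU21Cover

open scoped ComplexConjugate

theorem conjTranspose_mul_J_mul_apply (A : Matrix (Fin 3) (Fin 3) ℂ) (i k : Fin 3) :
    (Aᴴ * J * A) i k = conj (A 2 i) * A 0 k + conj (A 1 i) * A 1 k + conj (A 0 i) * A 2 k := by
  simp [J, Matrix.mul_apply, Fin.sum_univ_three]

/-- The continuous function `t` on the symmetric space with `2 t² = -⟨(τ,1), (τ,1)⟩`. -/
def height (τ : Dom) : ℝ := √(-((τ : Fin 2 → ℂ) 0).re - normSq ((τ : Fin 2 → ℂ) 1) / 2)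

theorem height_radicand_pos (τ : Dom) :
    0 < -((τ : Fin 2 → ℂ) 0).re - normSq ((τ : Fin 2 → ℂ) 1) / 2 := by
  have := (mem_Dom_iff _).1 τ.2
  linarith

theorem height_pos (τ : Dom) : 0 < height τ := Real.sqrt_pos.2 (height_radicand_pos τ)

theorem height_sq (τ : Dom) :
    height τ ^ 2 = -((τ : Fin 2 → ℂ) 0).re - normSq ((τ : Fin 2 → ℂ) 1) / 2 :=
  Real.sq_sqrt (height_radicand_pos τ).le

theorem continuous_height : Continuous height := by
  unfold height
  have h0 := continuous_Dom_apply 0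
  have h1 := continuous_normSq.comp (continuous_Dom_apply 1)
  exact ((continuous_re.comp h0).neg.sub (h1.div_const 2)).sqrt

/-- The matrix of `borelElt τ`. -/
def borelMat (τ : Dom) : Matrix (Fin 3) (Fin 3) ℂ :=
  !![(height τ : ℂ), -conj ((τ : Fin 2 → ℂ) 1), ((τ : Fin 2 → ℂ) 0 + height τ ^ 2) / height τ;
    0, 1, (τ : Fin 2 → ℂ) 1 / height τ;
    0, 0, 1 / height τ]

theorem height_sq_complex (τ : Dom) : 2 * (height τ : ℂ) ^ 2 =
    -(τ : Fin 2 → ℂ) 0 - conj ((τ : Fin 2 → ℂ) 0)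
      - conj ((τ : Fin 2 → ℂ) 1) * (τ : Fin 2 → ℂ) 1 := by
  have h := congrArg (fun x : ℝ => (x : ℂ)) (height_sq τ)
  push_cast at h
  rw [h, normSq_eq_conj_mul_self, re_eq_add_conj]
  ring

/-- The upper triangular element of `SU(2,1)`, with positive diagonal, that maps the base point
to `τ`. -/
def borelElt (τ : Dom) : SU21 :=
  ⟨⟨borelMat τ, by
    have : (height τ : ℂ) ≠ 0 := by exact_mod_cast (height_pos τ).ne'
    simp [borelMat, Matrix.det_fin_three, mul_inv_cancel₀ this]⟩, by
    have h0 : (height τ : ℂ) ≠ 0 := by exact_mod_cast (height_pos τ).ne'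
    have hs := height_sq_complex τ
    change (borelMat τ)ᴴ * J * borelMat τ = J
    ext i k
    rw [conjTranspose_mul_J_mul_apply]
    fin_cases i <;> fin_cases k <;> simp [borelMat, J] <;> field_simp <;>
      first | ring1 | linear_combination hs⟩

/-- The matrix of `rotElt`. -/
def rotMat (l p q : ℂ) : Matrix (Fin 3) (Fin 3) ℂ :=
  !![(conj l * conj q + l) / 2, p, (conj l * conj q - l) / 2;
    -(conj l * conj p), q, -(conj l * conj p);
    (conj l * conj q - l) / 2, p, (conj l * conj q + l) / 2]

/-- The elements of the stabilizer of the base point, a copy of `U(2)`. Here `l` is the eigenvalue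
on the negative vector `(-1, 0, 1)`, and `(√2 p, q)` is the second column of the unitary matrix by
which the element acts on the orthogonal complement of that vector. -/
def rotElt (l p q : ℂ) (hl : conj l * l = 1) (hpq : 2 * (conj p * p) + conj q * q = 1) : SU21 :=
  ⟨⟨rotMat l p q, by
    simp only [rotMat, Matrix.det_fin_three]
    simp
    linear_combination (2 * (conj p * p) + conj q * q) * hl + hpq⟩, by
    have h2 : conj (2 : ℂ) = 2 := Complex.conj_ofNat 2
    change (rotMat l p q)ᴴ * J * rotMat l p q = J
    ext i k
    rw [conjTranspose_mul_J_mul_apply]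
    fin_cases i <;> fin_cases k <;> simp [rotMat, J, h2] <;> grind⟩

theorem continuous_SU21_mk {A : Type*} [TopologicalSpace A] {g : A → SU21}
    (h : ∀ i k, Continuous fun a => mat (g a) i k) : Continuous g :=
  continuous_induced_rng.2 (continuous_induced_rng.2 (continuous_matrix h))

theorem continuous_borelElt : Continuous borelElt := by
  refine continuous_SU21_mk fun i k => ?_
  change Continuous fun τ => borelMat τ i k
  have h0 := continuous_Dom_apply 0
  have h1 := continuous_Dom_apply 1
  have hh : Continuous fun τ => (height τ : ℂ) := continuous_ofReal.comp continuous_height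
  have hn : ∀ τ, (height τ : ℂ) ≠ 0 := fun τ => by exact_mod_cast (height_pos τ).ne'
  fin_cases i <;> fin_cases k
  · exact hh
  · exact (continuous_conj.comp h1).neg
  · exact (h0.add (hh.pow 2)).div hh hn
  · exact continuous_const
  · exact continuous_const
  · exact h1.div hh hn
  · exact continuous_const
  · exact continuous_const
  · exact continuous_const.div hh hn

theorem continuous_rotElt {A : Type*} [TopologicalSpace A] {l p q : A → ℂ} (cl : Continuous l)
    (cp : Continuous p) (cq : Continuous q) (hl : ∀ a, conj (l a) * l a = 1)
    (hpq : ∀ a, 2 * (conj (p a) * p a) + conj (q a) * q a = 1) :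
    Continuous fun a => rotElt (l a) (p a) (q a) (hl a) (hpq a) := by
  refine continuous_SU21_mk fun i k => ?_
  change Continuous fun a => rotMat (l a) (p a) (q a) i k
  have cl' := continuous_conj.comp cl
  have cp' := continuous_conj.comp cp
  have cq' := continuous_conj.comp cq
  have h1 := ((cl'.mul cq').add cl).div_const 2
  have h2 := ((cl'.mul cq').sub cl).div_const 2
  have h3 := (cl'.mul cp').neg
  fin_cases i <;> fin_cases k
  exacts [h1, cp, h2, h3, cq, h3, h2, cp, h1]

theorem j_borelElt (τ σ : Dom) : j (borelElt τ) σ = (height τ : ℂ)⁻¹ := by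
  change borelMat τ 2 0 * _ + borelMat τ 2 1 * _ + borelMat τ 2 2 = _
  simp [borelMat]

theorem act_borelElt (τ : Dom) : act (borelElt τ) basePoint = τ := by
  have h0 : (height τ : ℂ) ≠ 0 := by exact_mod_cast (height_pos τ).ne'
  apply Subtype.ext
  ext i
  have hj := j_borelElt τ basePoint
  fin_cases i
  · change (borelMat τ 0 0 * _ + borelMat τ 0 1 * _ + borelMat τ 0 2) / j (borelElt τ) basePoint = _
    rw [hj]
    simp [borelMat, basePoint]
    field_simp
    ring
  · change (borelMat τ 1 0 * _ + borelMat τ 1 1 * _ + borelMat τ 1 2) / j (borelElt τ) basePoint = _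
    rw [hj]
    simp [borelMat, basePoint, h0]

theorem j_rotElt (l p q : ℂ) (hl hpq) : j (rotElt l p q hl hpq) basePoint = l := by
  change rotMat l p q 2 0 * _ + rotMat l p q 2 1 * _ + rotMat l p q 2 2 = _
  simp [rotMat, basePoint]
  ring

/-- Every element that fixes the base point is of the form `rotElt l p q`. -/
theorem stabilizer_basePoint (k : SU21) (hk : act k basePoint = basePoint) :
    conj (j k basePoint) * j k basePoint = 1 ∧
    2 * (conj (mat k 0 1) * mat k 0 1) + conj (mat k 1 1) * mat k 1 1 = 1 ∧
    mat k = rotMat (j k basePoint) (mat k 0 1) (mat k 1 1) := by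
  have hv := act_homVec k basePoint
  rw [hk] at hv
  have v0 := congrFun hv 0
  have v1 := congrFun hv 1
  have v2 := congrFun hv 2
  have u : ∀ a b, conj (mat k 2 a) * mat k 0 b + conj (mat k 1 a) * mat k 1 b
      + conj (mat k 0 a) * mat k 2 b = J a b := fun a b => by
    rw [← conjTranspose_mul_J_mul_apply, mat_conj]
  have hd : (mat k).det = 1 := k.1.2
  rw [Matrix.det_fin_three] at hd
  set l := j k basePoint with hl
  simp [mulVec, dotProduct, Fin.sum_univ_three, homVec, basePoint] at v0 v1 v2
  have u00 := u 0 0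
  have u01 := u 0 1
  have u02 := u 0 2
  have u10 := u 1 0
  have u11 := u 1 1
  have u12 := u 1 2
  have u20 := u 2 0
  have u21 := u 2 1
  have u22 := u 2 2
  simp [J] at u00 u01 u02 u10 u11 u12 u20 u21 u22
  have e02 : mat k 0 2 = mat k 0 0 - l := by linear_combination v0
  have e12 : mat k 1 2 = mat k 1 0 := by linear_combination v1
  have e22 : mat k 2 2 = mat k 2 0 + l := by linear_combination v2
  rw [e02, e12, e22] at hd u02 u12 u20 u21 u22
  simp only [map_add, map_sub] at u02 u12 u20 u21 u22
  have hll : conj l * l = 1 := by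
    linear_combination (-1/2 : ℂ) * (u00 - u02 - u20 + u22)
  have hl0 : conj l ≠ 0 := fun h => by simp [h] at hll
  have e21 : mat k 2 1 = mat k 0 1 := by
    apply mul_left_cancel₀ hl0
    linear_combination u01 - u21
  have e20 : mat k 2 0 = mat k 0 0 - l := by
    apply mul_left_cancel₀ hl0
    linear_combination hll + u00 - u20
  rw [e21] at u10 u11 hd
  rw [e20] at u10 hd
  have hpq : 2 * (conj (mat k 0 1) * mat k 0 1) + conj (mat k 1 1) * mat k 1 1 = 1 := by
    linear_combination u11
  have hd' : (2 * mat k 0 0 - l) * mat k 1 1 - 2 * mat k 1 0 * mat k 0 1 = conj l := by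
    linear_combination conj l * hd
      - ((2 * mat k 0 0 - l) * mat k 1 1 - 2 * mat k 1 0 * mat k 0 1) * hll
  have hs : 2 * mat k 0 0 - l = conj l * conj (mat k 1 1) := by
    linear_combination (-(2 * mat k 0 0 - l)) * hpq + 2 * mat k 0 1 * u10 + conj (mat k 1 1) * hd'
  have hm : mat k 1 0 = -(conj l * conj (mat k 0 1)) := by
    linear_combination (-mat k 1 0) * hpq + mat k 1 1 * u10 - conj (mat k 0 1) * hd'
  refine ⟨hll, hpq, ?_⟩
  ext a b
  fin_cases a <;> fin_cases b <;> simp [rotMat]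
  all_goals grind

end SU21Cover

end

/-! ### Simple connectedness of the covering group -/

noncomputable section
namespace SU21Cover

open scoped ComplexConjugate

/-- The norm on `ℂ²` for which `(p, q)` parametrizes the stabilizer of the base point exactly when
it has norm one. -/
def ellNorm (v : ℂ × ℂ) : ℝ := √(2 * normSq v.1 + normSq v.2)

theorem ellNorm_pos {v : ℂ × ℂ} (hv : v ≠ 0) : 0 < ellNorm v := by
  apply Real.sqrt_pos.2
  by_cases h1 : v.1 = 0
  · have h2 : v.2 ≠ 0 := fun h2 => hv (Prod.ext h1 h2)
    have := normSq_pos.2 h2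
    have := normSq_nonneg v.1
    positivity
  · have := normSq_pos.2 h1
    have := normSq_nonneg v.2
    positivity

theorem ellNorm_eq_one {v : ℂ × ℂ} (hv : 2 * (conj v.1 * v.1) + conj v.2 * v.2 = 1) :
    ellNorm v = 1 := by
  rw [← normSq_eq_conj_mul_self, ← normSq_eq_conj_mul_self] at hv
  have : 2 * normSq v.1 + normSq v.2 = 1 := by exact_mod_cast hv
  rw [ellNorm, this, Real.sqrt_one]

theorem continuous_ellNorm : Continuous ellNorm := by
  unfold ellNorm
  have h1 := continuous_normSq.comp (continuous_fst (X := ℂ) (Y := ℂ))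
  have h2 := continuous_normSq.comp (continuous_snd (X := ℂ) (Y := ℂ))
  exact ((continuous_const.mul h1).add h2).sqrt

theorem two_mul_add_normalized {v : ℂ × ℂ} (hv : v ≠ 0) :
    2 * (conj (v.1 / ellNorm v) * (v.1 / ellNorm v)) + conj (v.2 / ellNorm v) * (v.2 / ellNorm v)
      = 1 := by
  have h := ellNorm_pos hv
  have hs : ellNorm v ^ 2 = 2 * normSq v.1 + normSq v.2 := by
    apply Real.sq_sqrt
    have := normSq_nonneg v.1
    have := normSq_nonneg v.2
    positivity
  have hs' := congrArg (fun x : ℝ => (x : ℂ)) hs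
  push_cast at hs'
  rw [normSq_eq_conj_mul_self, normSq_eq_conj_mul_self] at hs'
  have h0 : (ellNorm v : ℂ) ≠ 0 := by exact_mod_cast h.ne'
  simp only [map_div₀, conj_ofReal]
  field_simp
  rw [hs']
  ring

theorem conj_exp_I_mul (y : ℝ) : conj (exp (I * y)) * exp (I * y) = 1 := by
  rw [← exp_conj, ← exp_add]
  simp

/-- The rotation part of a point of `LogCover.param`. -/
def rotPart (x : Dom × {v : ℂ × ℂ // v ≠ 0} × ℝ) : SU21 :=
  rotElt (exp (I * x.2.2)) (x.2.1.1.1 / ellNorm x.2.1.1) (x.2.1.1.2 / ellNorm x.2.1.1)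
    (conj_exp_I_mul _) (two_mul_add_normalized x.2.1.2)

theorem continuous_rotPart : Continuous rotPart := by
  have hv : Continuous fun x : Dom × {v : ℂ × ℂ // v ≠ 0} × ℝ => x.2.1.1 :=
    continuous_subtype_val.comp (continuous_fst.comp continuous_snd)
  have hN : Continuous fun x : Dom × {v : ℂ × ℂ // v ≠ 0} × ℝ => (ellNorm x.2.1.1 : ℂ) :=
    continuous_ofReal.comp (continuous_ellNorm.comp hv)
  have hN0 : ∀ x : Dom × {v : ℂ × ℂ // v ≠ 0} × ℝ, (ellNorm x.2.1.1 : ℂ) ≠ 0 :=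
    fun x => by exact_mod_cast (ellNorm_pos x.2.1.2).ne'
  refine continuous_rotElt ?_ ?_ ?_ _ _
  · exact (continuous_const.mul (continuous_ofReal.comp (continuous_snd.comp continuous_snd))).cexp
  · exact (continuous_fst.comp hv).div hN hN0
  · exact (continuous_snd.comp hv).div hN hN0

theorem exp_log_height (τ : Dom) : exp ((Real.log (height τ) : ℝ) : ℂ) = height τ := by
  rw [← ofReal_exp, Real.exp_log (height_pos τ)]

theorem act_inv_borelElt (τ : Dom) : act (borelElt τ)⁻¹ τ = basePoint := by
  have h := congrArg (act (borelElt τ)⁻¹) (act_borelElt τ)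
  rw [← act_mul, inv_mul_cancel, act_one] at h
  exact h.symm

namespace LogCover

/-- The Iwasawa decomposition, lifted to the covering group: an upper triangular element times an
element of the stabilizer of the base point. The vector in `ℂ²` is normalized. -/
def param (x : Dom × {v : ℂ × ℂ // v ≠ 0} × ℝ) : LogCover :=
  ⟨borelElt x.1 * rotPart x, I * x.2.2 - (Real.log (height x.1) : ℝ), by
    rw [j_mul, j_borelElt, rotPart, j_rotElt, exp_sub, exp_log_height]
    field_simp⟩

theorem continuous_param : Continuous param := by
  refine continuous_mk ((continuous_borelElt.comp _root_.continuous_fst).mul continuous_rotPart)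
    ?_ _
  refine Continuous.sub ?_ ?_
  · exact continuous_const.mul (continuous_ofReal.comp
      (_root_.continuous_snd.comp _root_.continuous_snd))
  · exact continuous_ofReal.comp ((continuous_height.comp _root_.continuous_fst).log
      fun x => (height_pos x.1).ne')

/-- The component in the stabilizer of the base point. -/
def stab (x : LogCover) : SU21 := (borelElt (act x.fst basePoint))⁻¹ * x.fst

theorem act_stab (x : LogCover) : act x.stab basePoint = basePoint := by
  rw [stab, act_mul, act_inv_borelElt]

theorem j_stab (x : LogCover) :
    j x.stab basePoint = height (act x.fst basePoint) * exp x.snd := by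
  have h : borelElt (act x.fst basePoint) * x.stab = x.fst := mul_inv_cancel_left _ _
  have h1 := x.exp_snd
  rw [← h, j_mul, j_borelElt] at h1
  have h0 : (height (act x.fst basePoint) : ℂ) ≠ 0 := by exact_mod_cast (height_pos _).ne'
  rw [h1]
  field_simp

/-- A right inverse of `param`. The vector in `ℂ²` is the second column, in the coordinates of
`rotElt`, of the stabilizer component. -/
def coord (x : LogCover) : Dom × {v : ℂ × ℂ // v ≠ 0} × ℝ :=
  (act x.fst basePoint, ⟨(mat x.stab 0 1, mat x.stab 1 1), fun h => by
    have h1 := (stabilizer_basePoint x.stab x.act_stab).2.1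
    rw [Prod.mk_eq_zero] at h
    simp [h.1, h.2] at h1⟩, x.snd.im)

theorem continuous_coord : Continuous coord := by
  have h1 : Continuous fun x : LogCover => act x.fst basePoint :=
    continuous_act_comp continuous_fst continuous_const
  have h2 : Continuous stab := (continuous_borelElt.comp h1).inv.mul continuous_fst
  exact h1.prodMk (Continuous.prodMk (Continuous.subtype_mk
    (((continuous_mat_apply 0 1).comp h2).prodMk ((continuous_mat_apply 1 1).comp h2)) _)
    (continuous_im.comp continuous_snd))

theorem snd_eq (x : LogCover) :
    x.snd = I * x.snd.im - (Real.log (height (act x.fst basePoint)) : ℝ) := by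
  have h := (stabilizer_basePoint x.stab x.act_stab).1
  have ht := height_pos (act x.fst basePoint)
  rw [j_stab, ← exp_log_height, ← exp_add, ← normSq_eq_conj_mul_self] at h
  have h' : normSq (exp (Real.log (height (act x.fst basePoint)) + x.snd)) = 1 := by
    exact_mod_cast h
  rw [normSq_eq_norm_sq, norm_exp, ← Real.exp_nat_mul, Real.exp_eq_one_iff] at h'
  simp at h'
  apply Complex.ext
  · simp
    linarith
  · simp

theorem param_coord (x : LogCover) : param (coord x) = x := by
  obtain ⟨-, h2, h3⟩ := stabilizer_basePoint x.stab x.act_stab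
  have hl : exp (I * x.snd.im) = j x.stab basePoint := by
    have h := congrArg exp x.snd_eq
    rw [exp_sub, exp_log_height] at h
    have h0 : (height (act x.fst basePoint) : ℂ) ≠ 0 := by exact_mod_cast (height_pos _).ne'
    rw [j_stab, h]
    field_simp
  have hN : ellNorm (mat x.stab 0 1, mat x.stab 1 1) = 1 := ellNorm_eq_one h2
  have hr : rotPart (coord x) = x.stab := by
    apply Subtype.ext
    apply Subtype.ext
    change rotMat (exp (I * x.snd.im))
      (mat x.stab 0 1 / ellNorm (mat x.stab 0 1, mat x.stab 1 1))
      (mat x.stab 1 1 / ellNorm (mat x.stab 0 1, mat x.stab 1 1)) = mat x.stab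
    rw [hN, ofReal_one, div_one, div_one, hl]
    exact h3.symm
  ext1
  · change borelElt (act x.fst basePoint) * rotPart (coord x) = x.fst
    rw [hr]
    exact mul_inv_cancel_left _ _
  · exact x.snd_eq.symm

instance : SimplyConnectedSpace LogCover := by
  have : SimplyConnectedSpace {v : ℂ × ℂ // v ≠ 0} :=
    simplyConnectedSpace_ne_zero (by simp [Module.finrank_prod, Complex.finrank_real_complex])
  exact simplyConnectedSpace_of_retract continuous_param continuous_coord param_coord

theorem isUniversalCover_proj : IsUniversalCover proj :=
  ⟨inferInstance, isCoveringMap_proj, isOpenQuotientMap_proj.surjective, inferInstance⟩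

end LogCover

end SU21Cover

end

/-! ### Uniqueness of universal covers -/

/-- Local path-connectedness lifts along a local homeomorphism. -/
theorem IsLocalHomeomorph.locallyPathConnectedSpace {X Y : Type*} [TopologicalSpace X]
    [TopologicalSpace Y] [LocallyPathConnectedSpace Y] {f : X → Y} (hf : IsLocalHomeomorph f) :
    LocallyPathConnectedSpace X := by
  let _ : ChartedSpace Y X :=
    { atlas := Set.range fun x => (hf x).choose
      chartAt := fun x => (hf x).choose
      mem_chart_source := fun x => (hf x).choose_spec.1
      chart_mem_atlas := fun x => ⟨x, rfl⟩ }
  exact ChartedSpace.locallyPathConnectedSpace Y X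

/-- A continuous homomorphism from a simply connected topological group lifts to a covering group
as a continuous homomorphism: the lift preserving the identity is multiplicative because both
`F (x y)` and `F x * F y` lift the same map on the connected space `E × E`. -/
theorem exists_monoidHom_lift {E E' G : Type*} [Group E] [TopologicalSpace E]
    [IsTopologicalGroup E] [Group E'] [TopologicalSpace E'] [IsTopologicalGroup E'] [Group G]
    [TopologicalSpace G] [SimplyConnectedSpace E] [LocallyPathConnectedSpace E]
    {π : E →* G} {π' : E' →* G} (hπ : Continuous π) (hπ' : IsCoveringMap π') :
    ∃ F : E →* E', Continuous F ∧ π'.comp F = π := by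
  obtain ⟨F, ⟨h1, hF⟩, -⟩ :=
    hπ'.existsUnique_continuousMap_lifts (⟨π, hπ⟩ : C(E, G)) 1 1 (by simp)
  have hF' : ∀ x, π' (F x) = π x := fun x => congrFun hF x
  have hmul : (fun p : E × E => F (p.1 * p.2)) = fun p : E × E => F p.1 * F p.2 := by
    refine hπ'.eq_of_comp_eq (by fun_prop) (by fun_prop) ?_ (1, 1) (by simp [h1])
    ext p
    simp [hF']
  exact ⟨{ toFun := F, map_one' := h1, map_mul' := fun x y => congrFun hmul (x, y) }, F.continuous,
    MonoidHom.ext hF'⟩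

/-- A continuous endomorphism of a connected covering group over the base is the identity. -/
theorem eq_id_of_comp_eq {E G : Type*} [Group E] [TopologicalSpace E] [PreconnectedSpace E]
    [Group G] [TopologicalSpace G] {π : E →* G} (hπ : IsCoveringMap π) {F : E →* E}
    (hF : Continuous F) (h : π.comp F = π) (x : E) : F x = x :=
  congrFun (hπ.eq_of_comp_eq hF continuous_id (funext fun x => DFunLike.congr_fun h x) 1
    (map_one F)) x

/-- Uniqueness of the universal cover of a locally path-connected group. -/
theorem SU21Cover.IsUniversalCover.exists_mulEquiv {E E' G : Type*} [Group E] [TopologicalSpace E]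
    [Group E'] [TopologicalSpace E'] [Group G] [TopologicalSpace G] [LocallyPathConnectedSpace G]
    {π : E →* G} {π' : E' →* G} (h : IsUniversalCover π) (h' : IsUniversalCover π') :
    ∃ e : E ≃* E', Continuous e ∧ Continuous e.symm ∧ ∀ x, π' (e x) = π x := by
  have := h.isTopologicalGroup
  have := h'.isTopologicalGroup
  have := h.simplyConnected
  have := h'.simplyConnected
  have := h.isCoveringMap.isLocalHomeomorph.locallyPathConnectedSpace
  have := h'.isCoveringMap.isLocalHomeomorph.locallyPathConnectedSpace
  obtain ⟨F, hFc, hF⟩ := exists_monoidHom_lift h.isCoveringMap.continuous h'.isCoveringMap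
  obtain ⟨K, hKc, hK⟩ := exists_monoidHom_lift h'.isCoveringMap.continuous h.isCoveringMap
  have hKF : ∀ x, K (F x) = x := eq_id_of_comp_eq (F := K.comp F) h.isCoveringMap
    (hKc.comp hFc) (by rw [← MonoidHom.comp_assoc, hK, hF])
  have hFK : ∀ x, F (K x) = x := eq_id_of_comp_eq (F := F.comp K) h'.isCoveringMap
    (hFc.comp hKc) (by rw [← MonoidHom.comp_assoc, hF, hK])
  exact ⟨{ toFun := F, invFun := K, left_inv := hKF, right_inv := hFK, map_mul' := map_mul F },
    hFc, hKc, fun x => DFunLike.congr_fun hF x⟩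

noncomputable section
namespace SU21Cover

instance : LocallyPathConnectedSpace SU21 := by
  have h1 : LocallyPathConnectedSpace Dom := by
    have ho : IsOpen Dom := by
      have : Dom = {τ : Fin 2 → ℂ | 2 * (τ 0).re + normSq (τ 1) < 0} := by
        ext τ
        exact mem_Dom_iff τ
      rw [this]
      have := continuous_normSq.comp (continuous_apply (A := fun _ : Fin 2 => ℂ) 1)
      exact isOpen_lt (by simp only [Function.comp_def] at this; fun_prop) continuous_const
    exact ho.locallyPathConnectedSpace
  have h2 : LocallyPathConnectedSpace {v : ℂ × ℂ // v ≠ 0} :=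
    (isOpen_compl_singleton (x := (0 : ℂ × ℂ))).locallyPathConnectedSpace
  have h3 : IsQuotientMap LogCover.param :=
    IsQuotientMap.of_comp LogCover.continuous_coord LogCover.continuous_param (by
      rw [show LogCover.param ∘ LogCover.coord = id from funext LogCover.param_coord]
      exact IsQuotientMap.id)
  exact (LogCover.isOpenQuotientMap_proj.isQuotientMap.comp h3).locallyPathConnectedSpace

end SU21Cover

end

theorem mainTheorem10 :
    -- each `logJ g` is a continuous branch of the logarithm of `j g`
    (∀ g : SU21, Continuous (logJ g) ∧ ∀ τ : Dom, Complex.exp (logJ g τ) = j g τ) ∧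
    -- `sigma` is given by the defining formula, at every point
    (∀ (g h : SU21) (τ : Dom), (sigma g h : ℂ) =
      1 / (2 * Real.pi * Complex.I) * (logJ (g * h) τ - logJ g (act h τ) - logJ h τ)) ∧
    -- `sigma` is a measurable cocycle, and its class is that of the universal cover
    ∃ hσ : sigma ∈ Z2meas SU21,
      (∃ (E : Type) (_ : Group E) (_ : TopologicalSpace E) (π : E →* SU21),
        IsUniversalCover π) ∧
      ∀ (E : Type*) [Group E] [TopologicalSpace E] (π : E →* SU21), IsUniversalCover π →
        ∃ S : TopCentralExtension E SU21,
          S.rightHom = π ∧ S.HasClass (H2meas.mk ⟨sigma, hσ⟩) := by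
  refine ⟨fun g => ⟨continuous_logJ g, exp_logJ g⟩, sigma_eq, sigma_mem,
    ⟨LogCover, inferInstance, inferInstance, LogCover.proj, LogCover.isUniversalCover_proj⟩, ?_⟩
  intro E _ _ π hπ
  obtain ⟨e, he, he', heπ⟩ := LogCover.isUniversalCover_proj.exists_mulEquiv hπ
  have heπ' : ∀ x, LogCover.proj (e.symm x) = π x := fun x => by
    rw [← heπ, e.apply_symm_apply]
  let eh : LogCover ≃ₜ E :=
    { toEquiv := e.toEquiv, continuous_toFun := he, continuous_invFun := he' }
  refine ⟨{
    inl := e.toMonoidHom.comp LogCover.incl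
    rightHom := π
    inl_injective := e.injective.comp LogCover.isClosedEmbedding_incl.injective
    range_inl_eq_ker_rightHom := by
      rw [MonoidHom.range_comp, LogCover.range_incl]
      ext x
      rw [Subgroup.mem_map, MonoidHom.mem_ker]
      constructor
      · rintro ⟨y, hy, rfl⟩
        exact (heπ y).trans hy
      · intro hx
        exact ⟨e.symm x, (heπ' x).trans hx, e.apply_symm_apply x⟩
    rightHom_surjective := hπ.surjective
    central := fun n x => by
      have := congrArg e (LogCover.incl_mul_comm n (e.symm x))
      simpa using this
    isClosedEmbedding_inl := eh.isClosedEmbedding.comp LogCover.isClosedEmbedding_incl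
    isOpenQuotientMap_rightHom :=
      ⟨hπ.surjective, hπ.isCoveringMap.continuous, hπ.isCoveringMap.isOpenMap⟩ }, rfl,
    fun g => e (LogCover.sec g), ?_, fun g => heπ _, ⟨sigma, sigma_mem⟩, fun g h => ?_, rfl⟩
  · let _ : MeasurableSpace E := borel E
    have : BorelSpace E := ⟨rfl⟩
    let _ : MeasurableSpace LogCover := borel LogCover
    have : BorelSpace LogCover := ⟨rfl⟩
    exact he.measurable.comp LogCover.measurable_sec
  · rw [← map_mul, LogCover.sec_mul_sec, map_mul]
    rfl
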